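/- Let $A$ and $B$ be finite-dimensional unital $C^*$-algebras over $\mathbb{C}$. Let $Z(A)=\{a\in A : ab=ba \text{ for all } b\in A\}$ be the center of $A$, and let $A\otimes B$ be the tensor product over $\mathbb{C}$, with $(a_1\otimes b_1)(a_2\otimes b_2)=a_1a_2\otimes b_1b_2$ and $(a\otimes b)^*=a^*\otimes b^*$. An element $x$ of any of these $*$-algebras is called positive if $x=y^*y$ for some element $y$ of that algebra, and a PU map is a $\mathbb{C}$-linear map that preserves the unit and positive elements. Let $\kappa_1\colon A\to A\otimes B$, $\kappa_1(a)=a\otimes 1$, and $\kappa_2\colon B\to A\otimes B$, $\kappa_2(b)=1\otimes b$, and let $\mu\colon A\otimes Z(A)\to A$ be the linear map with $\mu(a\otimes z)=az$. Then there is a bijection $$\mathrm{gr}\colon \{\text{PU maps } f\colon B\to Z(A)\}\longrightarrow\{\text{PU maps } g\colon A\otimes B\to A \text{ with } g\circ\kappa_1=\mathrm{id}_A\}$$ given by $\mathrm{gr}(f)=\mu\circ(\mathrm{id}_A\otimes f)$, that is, $\mathrm{gr}(f)(a\otimes b)=a\cdot f(b)=f(b)\cdot a$ for all $a\in A$, $b\in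 B$. Its inverse sends $g$ to $g\circ\kappa_2$, which takes values in $Z(A)$. If $A$ is commutative, then $Z(A)$ can be replaced by $A$: there is a bijection between PU maps $f\colon B\to A$ and PU maps $g\colon A\otimes B\to A$ with $g\circ\kappa_1=\mathrm{id}_A$, which sends $f$ to the linear map $\mathrm{gr}(f)$ with $\mathrm{gr}(f)(a\otimes b)=a\cdot f(b)=f(b)\cdot a$, and whose inverse sends $g$ to $g\circ\kappa_2$. -/

import Mathlib

open scoped TensorProduct

/-- An element `a` of a `*`-algebra is positive if `a = b* b` for some element `b`. -/
def IsPositiveElt {A : Type*} [Mul A] [Star A] (a : A) : Prop :=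
  ∃ b : A, a = star b * b

/-- In a C*-algebra with its usual order this is the usual positivity. -/
theorem isPositiveElt_iff_nonneg {A : Type*} [CStarAlgebra A] [PartialOrder A]
    [StarOrderedRing A] (a : A) : IsPositiveElt a ↔ 0 ≤ a :=
  CStarAlgebra.nonneg_iff_eq_star_mul_self.symm

/-- Positive unital (PU) maps: `ℂ`-linear maps preserving the unit and positive elements. Only the
`*`-algebra structure enters, so the notion applies to C*-algebras and to the algebraic tensor
product of two of them (which in finite dimension is the C*-tensor product). -/
@[ext]
structure PUMap (A B : Type*) [Ring A] [StarRing A] [Algebra ℂ A]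
    [Ring B] [StarRing B] [Algebra ℂ B] where
  toLinearMap : A →ₗ[ℂ] B
  map_one : toLinearMap 1 = 1
  map_pos : ∀ a : A, IsPositiveElt a → IsPositiveElt (toLinearMap a)

namespace PUMap

section

variable {A B C : Type*} [Ring A] [StarRing A] [Algebra ℂ A] [Ring B] [StarRing B] [Algebra ℂ B]
  [Ring C] [StarRing C] [Algebra ℂ C]

instance : FunLike (PUMap A B) A B where
  coe f := f.toLinearMap
  coe_injective _ _ h := PUMap.ext (DFunLike.coe_injective h)

/-- The identity PU map. -/
protected def id (A : Type*) [Ring A] [StarRing A] [Algebra ℂ A] : PUMap A A where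
  toLinearMap := LinearMap.id
  map_one := rfl
  map_pos _ h := h

/-- Composition `g ∘ f` of PU maps. -/
def comp (g : PUMap B C) (f : PUMap A B) : PUMap A C where
  toLinearMap := g.toLinearMap ∘ₗ f.toLinearMap
  map_one := by simp [f.map_one, g.map_one]
  map_pos a h := g.map_pos _ (f.map_pos a h)

/-- A unital `*`-homomorphism (MIU map) is a PU map. -/
def ofStarAlgHom (f : A →⋆ₐ[ℂ] B) : PUMap A B where
  toLinearMap := f.toAlgHom.toLinearMap
  map_one := _root_.map_one f
  map_pos := by
    rintro _ ⟨b, rfl⟩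
    exact ⟨f b, (map_mul f _ _).trans (by rw [map_star])⟩

end

end PUMap

section

variable (A B : Type*) [CStarAlgebra A] [CStarAlgebra B]

/-- The center `Z(A) = {a | ∀ b, a b = b a}` of a C*-algebra, as a `*`-subalgebra. -/
def cstarCenter : StarSubalgebra ℂ A where
  toSubalgebra := Subalgebra.center ℂ A
  star_mem' h := Set.star_mem_center h

theorem mem_cstarCenter_iff {a : A} : a ∈ cstarCenter A ↔ ∀ b : A, a * b = b * a :=
  (Subalgebra.mem_center_iff (R := ℂ) (a := a)).trans (forall_congr' fun _ => eq_comm)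

/-- The coprojection `κ₁ : A → A ⊗ B`, `κ₁ a = a ⊗ 1`. -/
noncomputable def kappaOne : A →⋆ₐ[ℂ] A ⊗[ℂ] B where
  toAlgHom := Algebra.TensorProduct.includeLeft
  map_star' a := by simp

/-- The coprojection `κ₂ : B → A ⊗ B`, `κ₂ b = 1 ⊗ b`. -/
noncomputable def kappaTwo : B →⋆ₐ[ℂ] A ⊗[ℂ] B where
  toAlgHom := Algebra.TensorProduct.includeRight
  map_star' b := by simp

/-- Multiplication by central elements: `μ : A ⊗ Z(A) → A`, `μ (a ⊗ z) = a z`. -/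
noncomputable def centerMul : A ⊗[ℂ] cstarCenter A →⋆ₐ[ℂ] A where
  toAlgHom := Algebra.TensorProduct.lift (AlgHom.id ℂ A) (cstarCenter A).subtype.toAlgHom
    fun a z => ((mem_cstarCenter_iff A).1 z.2 a).symm
  map_star' x := by
    induction x with
    | zero => simp
    | add x y hx hy => simp_all
    | tmul a z =>
      change star a * star (z : A) = star (a * (z : A))
      rw [star_mul]
      exact ((mem_cstarCenter_iff A).1 (star_mem z.2) (star a)).symm

theorem centerMul_tmul (a : A) (z : cstarCenter A) :
    centerMul A (a ⊗ₜ[ℂ] z) = a * (z : A) := rfl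

end

/-- `gr(f) = μ ∘ (id ⊗ f) : A ⊗ B → A`, as a linear map. -/
noncomputable def grLinear {A B : Type*} [CStarAlgebra A] [CStarAlgebra B]
    (f : PUMap B (cstarCenter A)) : A ⊗[ℂ] B →ₗ[ℂ] A :=
  (centerMul A).toAlgHom.toLinearMap ∘ₗ TensorProduct.map LinearMap.id f.toLinearMap

/-- PU maps `g : A ⊗ B → A` with `g ∘ κ₁ = id`. -/
abbrev PURetraction (A B : Type*) [CStarAlgebra A] [CStarAlgebra B] : Type _ :=
  {g : PUMap (A ⊗[ℂ] B) A // g.comp (PUMap.ofStarAlgHom (kappaOne A B)) = PUMap.id A}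

/-! For gr(f): Z(A) is commutative and finite-dimensional, so it is spanned by the projections p_χ
dual to its characters χ, and f = Σ_χ (χ ∘ f) p_χ. Each χ ∘ f is a positive functional, whose Gram
matrices are sums of rank-one matrices; hence gr(f)(y* y) is a sum of squares
(`PUMap.grLinear_map_pos`).

Conversely, let g be a retraction of κ₁. For a projection p and 0 ≤ b ≤ 1, we have 0 ≤ g(p ⊗ b) ≤ p,
so p is a unit for g(p ⊗ b); likewise for 1 - p. Projections span A and such b span B, so g(a ⊗ b) =
a g(1 ⊗ b) = g(1 ⊗ b) a (`PURetraction.apply_tmul`). Thus g(1 ⊗ b) is central and g is determined by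
g ∘ κ₂. -/

/-! ### Projections, positive elements and positive functionals -/

open WeakDual in
theorem finite_characterSpace (Z : Type*) [CommCStarAlgebra Z] [FiniteDimensional ℂ Z] :
    Finite (characterSpace ℂ Z) := by
  -- Dedekind: distinct characters are linearly independent in the finite-dimensional dual.
  have h := (linearIndependent_toLinearMap ℂ Z ℂ).finite
  refine Finite.of_injective (fun χ : characterSpace ℂ Z => CharacterSpace.toAlgHom χ) ?_
  intro χ ψ h
  ext z
  exact DFunLike.congr_fun h z

open WeakDual in
/-- A finite-dimensional commutative C*-algebra is spanned by the projections dual to its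
characters. -/
theorem exists_projections_characterSpace (Z : Type*) [CommCStarAlgebra Z] [FiniteDimensional ℂ Z]
    [Fintype (characterSpace ℂ Z)] :
    ∃ p : characterSpace ℂ Z → Z, (∀ χ, star (p χ) = p χ) ∧ (∀ χ, p χ * p χ = p χ) ∧
      ∀ z : Z, z = ∑ χ, χ z • p χ := by
  classical
  let d (χ : characterSpace ℂ Z) : C(characterSpace ℂ Z, ℂ) :=
    ⟨fun ψ => if ψ = χ then 1 else 0, continuous_of_discreteTopology⟩
  let e := gelfandStarTransform Z
  refine ⟨fun χ => e.symm (d χ), fun χ => ?_, fun χ => ?_, fun z => ?_⟩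
  · rw [← map_star]
    congr 1
    ext ψ
    simp [d]
  · rw [← map_mul]
    congr 1
    ext ψ
    simp [d]
  · apply EquivLike.injective e
    ext ψ
    simp only [map_sum, map_smul, StarAlgEquiv.apply_symm_apply, ContinuousMap.sum_apply]
    simpa [d] using show e z ψ = ψ z from rfl

theorem IsPositiveElt.add {A : Type*} [CStarAlgebra A] {a b : A} (ha : IsPositiveElt a)
    (hb : IsPositiveElt b) : IsPositiveElt (a + b) := by
  let := CStarAlgebra.spectralOrder A
  have := CStarAlgebra.spectralOrderedRing A
  rw [isPositiveElt_iff_nonneg] at *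
  exact add_nonneg ha hb

theorem IsPositiveElt.zero {A : Type*} [Ring A] [StarRing A] : IsPositiveElt (0 : A) :=
  ⟨0, by simp⟩

theorem IsPositiveElt.sum {A : Type*} [CStarAlgebra A] {ι : Type*} (s : Finset ι) (a : ι → A)
    (h : ∀ i ∈ s, IsPositiveElt (a i)) : IsPositiveElt (∑ i ∈ s, a i) :=
  Finset.sum_induction _ _ (fun _ _ => IsPositiveElt.add) .zero h

/-- A C*-algebra is spanned by the elements `b` such that `b` and `1 - b` are positive. -/
theorem span_positive_contractions (B : Type*) [CStarAlgebra B] :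
    Submodule.span ℂ {b : B | IsPositiveElt b ∧ IsPositiveElt (1 - b)} = ⊤ := by
  let := CStarAlgebra.spectralOrder B
  have := CStarAlgebra.spectralOrderedRing B
  rw [eq_top_iff, ← CStarAlgebra.span_nonneg_inter_unitClosedBall]
  refine Submodule.span_mono ?_
  rintro b ⟨hb, hb1⟩
  simp only [Set.mem_ofPred_eq, isPositiveElt_iff_nonneg, sub_nonneg] at *
  exact ⟨hb, CStarAlgebra.norm_le_one_iff_of_nonneg b |>.1 (by simpa using hb1)⟩

/-- A finite-dimensional C*-algebra is spanned by its projections. -/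
theorem span_projections (A : Type*) [CStarAlgebra A] [FiniteDimensional ℂ A] :
    Submodule.span ℂ {p : A | star p = p ∧ p * p = p} = ⊤ := by
  let := CStarAlgebra.spectralOrder A
  have := CStarAlgebra.spectralOrderedRing A
  rw [eq_top_iff, ← CStarAlgebra.span_nonneg, Submodule.span_le]
  intro a (ha : 0 ≤ a)
  have : IsStarNormal a := (IsSelfAdjoint.of_nonneg ha).isStarNormal
  -- As `a` is normal, it generates a commutative C*-algebra, where the character projections are
  -- available.
  let E := StarAlgebra.elemental ℂ a
  have : FiniteDimensional ℂ E :=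
    FiniteDimensional.of_injective E.subtype.toAlgHom.toLinearMap Subtype.val_injective
  have := finite_characterSpace E
  let := Fintype.ofFinite (WeakDual.characterSpace ℂ E)
  obtain ⟨p, hs, hm, h⟩ := exists_projections_characterSpace E
  have := congrArg E.subtype (h ⟨a, StarAlgebra.elemental.self_mem ℂ a⟩)
  rw [map_sum] at this
  change a ∈ _
  rw [show a = _ from this]
  refine Submodule.sum_mem _ fun χ _ => ?_
  rw [map_smul]
  exact Submodule.smul_mem _ _ (Submodule.subset_span
    ⟨congrArg Subtype.val (hs χ), congrArg Subtype.val (hm χ)⟩)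

/-- A positive linear functional on a C*-algebra preserves adjoints. -/
theorem map_star_of_map_star_mul_self_nonneg {B : Type*} [CStarAlgebra B] (φ : B →ₗ[ℂ] ℂ)
    (hφ : ∀ b, ∃ r : ℝ, 0 ≤ r ∧ φ (star b * b) = r) (b : B) :
    φ (star b) = star (φ b) := by
  have hb : b ∈ Submodule.span ℂ {b : B | IsPositiveElt b ∧ IsPositiveElt (1 - b)} := by
    rw [span_positive_contractions]; trivial
  induction hb using Submodule.span_induction with
  | mem x hx =>
    obtain ⟨⟨c, rfl⟩, -⟩ := hx
    obtain ⟨r, -, hr⟩ := hφ c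
    simp [hr]
  | zero => simp
  | add x y _ _ hx hy => simp [hx, hy]
  | smul c x _ hx => simp [hx]

open ComplexOrder in
/-- For a positive functional `φ`, the Gram matrix `φ (bᵢ* bⱼ)` is a sum of rank one matrices. -/
theorem exists_gram_decomposition {B : Type*} [CStarAlgebra B] (φ : B →ₗ[ℂ] ℂ)
    (hφ : ∀ b, ∃ r : ℝ, 0 ≤ r ∧ φ (star b * b) = r) {n : ℕ} (b : Fin n → B) :
    ∃ (m : ℕ) (v : Fin m → Fin n → ℂ),
      ∀ i j, φ (star (b i) * b j) = ∑ l, star (v l i) * v l j := by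
  let M : Matrix (Fin n) (Fin n) ℂ := .of fun i j => φ (star (b i) * b j)
  have hM : M.PosSemidef := by
    refine .of_dotProduct_mulVec_nonneg ?_ fun x => ?_
    · ext i j
      simp [M, ← map_star_of_map_star_mul_self_nonneg φ hφ]
    -- The quadratic form is x* M x = φ(c* c) with c = Σ xᵢ bᵢ.
    · obtain ⟨r, hr, h⟩ := hφ (∑ i, x i • b i)
      have : star x ⬝ᵥ (M.mulVec x) = r := by
        rw [← h]
        rw [star_sum, Finset.sum_mul_sum]
        simp only [dotProduct, Matrix.mulVec, M, Matrix.of_apply, map_sum, Finset.mul_sum,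
          star_smul, smul_mul_smul_comm, map_smul, smul_eq_mul, Pi.star_apply]
        exact Finset.sum_congr rfl fun i _ => Finset.sum_congr rfl fun j _ => by ring
      rw [this]
      exact_mod_cast hr
  obtain ⟨m, v, h⟩ := Matrix.posSemidef_iff_eq_sum_vecMulVec.1 hM
  -- The rank-one terms have entries `v l i * star (v l j)`; conjugating `v` moves the star to the
  -- index `i`.
  refine ⟨m, fun l => star (v l), fun i j => ?_⟩
  have := congrFun (congrFun h i) j
  simpa [M, Matrix.sum_apply, Matrix.vecMulVec_apply] using this

/-- If `p` is a projection, `x` is positive and `p - x` is positive, then `p` is a unit for `x`. -/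
theorem mul_eq_self_of_positive_le_projection {A : Type*} [CStarAlgebra A] {p x : A}
    (hs : star p = p) (hm : p * p = p) (hx : IsPositiveElt x) (hpx : IsPositiveElt (p - x)) :
    x * p = x ∧ p * x = x := by
  obtain ⟨y, rfl⟩ := hx
  let := CStarAlgebra.spectralOrder A
  have := CStarAlgebra.spectralOrderedRing A
  rw [isPositiveElt_iff_nonneg, sub_nonneg] at hpx
  -- With x = y* y, compressing x ≤ p by 1 - p gives (1 - p) x (1 - p) ≤ 0, so y (1 - p) = 0.
  have h := star_left_conjugate_le_conjugate hpx (1 - p)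
  have h0 : star (y * (1 - p)) * (y * (1 - p)) = 0 := by
    refine le_antisymm ?_ (star_mul_self_nonneg _)
    convert h using 1
    · simp only [star_mul, mul_assoc]
    · simp [hs, mul_sub, sub_mul, hm]
  rw [CStarRing.star_mul_self_eq_zero_iff] at h0
  have hy : y * p = y := by rw [mul_sub, mul_one, sub_eq_zero] at h0; exact h0.symm
  have hy' : p * star y = star y := by simpa [hs] using congrArg star hy
  exact ⟨by rw [mul_assoc, hy], by rw [← mul_assoc, hy']⟩

/-- A central element which is positive in the algebra is positive in the center. -/
theorem isPositiveElt_cstarCenter {A : Type*} [CStarAlgebra A] {z : cstarCenter A}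
    (hz : IsPositiveElt (z : A)) : IsPositiveElt z := by
  let := CStarAlgebra.spectralOrder A
  have := CStarAlgebra.spectralOrderedRing A
  rw [isPositiveElt_iff_nonneg] at hz
  -- The square root commutes with whatever commutes with `z`, so it is again central.
  refine ⟨⟨CFC.sqrt (z : A), (mem_cstarCenter_iff A).2 fun b => ?_⟩, Subtype.ext ?_⟩
  · exact Commute.cfcₙ_nnreal ((mem_cstarCenter_iff A).1 z.2 b) _
  · change (z : A) = star (CFC.sqrt (z : A)) * CFC.sqrt (z : A)
    rw [(IsSelfAdjoint.of_nonneg (CFC.sqrt_nonneg _)).star_eq, CFC.sqrt_mul_sqrt_self _ hz]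

/-! ### Positivity of gr(f) -/

namespace PUMap

section

variable {A B : Type*} [CStarAlgebra A] [CStarAlgebra B]

/-- A PU map with central values, as a PU map into the center. -/
def codRestrictCenter (f : PUMap B A) (h : ∀ b, f b ∈ cstarCenter A) :
    PUMap B (cstarCenter A) where
  toLinearMap := f.toLinearMap.codRestrict (Subalgebra.toSubmodule (cstarCenter A).toSubalgebra) h
  map_one := Subtype.ext f.map_one
  map_pos b hb := isPositiveElt_cstarCenter (f.map_pos b hb)

theorem grLinear_tmul (f : PUMap B (cstarCenter A)) (a : A) (b : B) :
    grLinear f (a ⊗ₜ[ℂ] b) = a * (f b : A) := rfl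

variable [FiniteDimensional ℂ A]

theorem grLinear_map_pos (f : PUMap B (cstarCenter A)) (x : A ⊗[ℂ] B) (hx : IsPositiveElt x) :
    IsPositiveElt (grLinear f x) := by
  obtain ⟨y, rfl⟩ := hx
  obtain ⟨n, a, b, rfl⟩ : ∃ (n : ℕ) (a : Fin n → A) (b : Fin n → B),
      y = ∑ i, a i ⊗ₜ[ℂ] b i := by
    obtain ⟨S, hS⟩ := TensorProduct.exists_finset y
    refine ⟨S.card, fun i => (S.equivFin.symm i).1.1, fun i => (S.equivFin.symm i).1.2, ?_⟩
    rw [hS, ← Finset.sum_coe_sort]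
    exact (Equiv.sum_comp S.equivFin.symm fun i : S => i.1.1 ⊗ₜ[ℂ] i.1.2).symm
  have : FiniteDimensional ℂ (cstarCenter A) :=
    FiniteDimensional.of_injective (cstarCenter A).subtype.toAlgHom.toLinearMap
      Subtype.val_injective
  have : IsClosed (cstarCenter A : Set A) :=
    Submodule.closed_of_finiteDimensional (Subalgebra.toSubmodule (cstarCenter A).toSubalgebra)
  let : CommCStarAlgebra (cstarCenter A) :=
    { StarSubalgebra.cstarAlgebra (cstarCenter A) with
      mul_comm := fun x y => Subtype.ext ((mem_cstarCenter_iff A).1 x.2 y) }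
  have := finite_characterSpace (cstarCenter A)
  let := Fintype.ofFinite (WeakDual.characterSpace ℂ (cstarCenter A))
  obtain ⟨p, hs, hm, hp⟩ := exists_projections_characterSpace (cstarCenter A)
  have hφ (χ : WeakDual.characterSpace ℂ (cstarCenter A)) (b : B) :
      ∃ r : ℝ, 0 ≤ r ∧ χ (f (star b * b)) = r := by
    obtain ⟨z, hz⟩ := f.map_pos _ ⟨b, rfl⟩
    refine ⟨Complex.normSq (χ z), Complex.normSq_nonneg _, ?_⟩
    rw [show f (star b * b) = star z * z from hz, map_mul, map_star, Complex.normSq_eq_conj_mul_self]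
    rfl
  choose m v hv using fun χ => exists_gram_decomposition
    ((WeakDual.CharacterSpace.toAlgHom χ).toLinearMap ∘ₗ f.toLinearMap) (hφ χ) b
  have hf (i j : Fin n) : (f (star (b i) * b j) : A) =
      ∑ χ, ∑ l, (star (v χ l i) * v χ l j) • (p χ : A) := by
    conv_lhs => rw [hp (f (star (b i) * b j))]
    rw [← (cstarCenter A).subtype_apply, map_sum]
    refine Finset.sum_congr rfl fun χ _ => ?_
    rw [map_smul, ← Finset.sum_smul, ← hv χ i j]
    rfl
  have key : grLinear f (star (∑ i, a i ⊗ₜ[ℂ] b i) * ∑ i, a i ⊗ₜ[ℂ] b i) =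
      ∑ χ, ∑ l, star (∑ i, v χ l i • (a i * (p χ : A))) * ∑ i, v χ l i • (a i * (p χ : A)) := by
    -- A central projection can be split as p = p* p and shared between both factors.
    have h1 (χ) (i j : Fin n) :
        star (a i) * a j * (p χ : A) = star (a i * (p χ : A)) * (a j * (p χ : A)) := by
      have h2 : star (p χ : A) = p χ := congrArg Subtype.val (hs χ)
      have h3 : (p χ : A) * p χ = p χ := congrArg Subtype.val (hm χ)
      have h4 := (mem_cstarCenter_iff A).1 (p χ).2
      rw [star_mul, h2, h4 (star (a i)), mul_assoc (star (a i)) (p χ : A),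
        ← mul_assoc (p χ : A) (a j), h4 (a j), mul_assoc (a j), h3, mul_assoc]
    simp_rw [star_sum, Finset.sum_mul_sum, map_sum, TensorProduct.star_tmul,
      Algebra.TensorProduct.tmul_mul_tmul, grLinear_tmul, hf, star_smul, smul_mul_smul_comm,
      Finset.mul_sum, mul_smul_comm, h1]
    refine (Finset.sum_congr rfl fun i _ => Finset.sum_comm).trans (Finset.sum_comm.trans ?_)
    exact Finset.sum_congr rfl fun χ _ =>
      (Finset.sum_congr rfl fun i _ => Finset.sum_comm).trans Finset.sum_comm
  rw [key]
  exact IsPositiveElt.sum _ _ fun χ _ => IsPositiveElt.sum _ _ fun l _ => ⟨_, rfl⟩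

/-- `gr f = μ ∘ (id ⊗ f)`, as a PU retraction of `κ₁`. -/
noncomputable def gr (f : PUMap B (cstarCenter A)) : PURetraction A B :=
  ⟨{ toLinearMap := grLinear f
     map_one := by
      rw [Algebra.TensorProduct.one_def, grLinear_tmul, one_mul]
      exact congrArg Subtype.val f.map_one
     map_pos := grLinear_map_pos f }, by
    apply PUMap.ext
    ext a
    change a * (f 1 : A) = a
    rw [show f 1 = 1 from f.map_one]
    exact mul_one a⟩

end

end PUMap

/-! ### Retractions of κ₁ are A-bimodule maps -/

namespace PURetraction

variable {A B : Type*} [CStarAlgebra A] [CStarAlgebra B]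

theorem apply_tmul_one (g : PURetraction A B) (a : A) : g.1 (a ⊗ₜ[ℂ] 1) = a :=
  congrArg (fun h : PUMap A A => h a) g.2

variable [FiniteDimensional ℂ A]

theorem apply_tmul (g : PURetraction A B) (a : A) (b : B) :
    g.1 (a ⊗ₜ[ℂ] b) = a * g.1 (1 ⊗ₜ[ℂ] b) ∧ g.1 (a ⊗ₜ[ℂ] b) = g.1 (1 ⊗ₜ[ℂ] b) * a := by
  let G : A ⊗[ℂ] B →ₗ[ℂ] A := g.1.toLinearMap
  have hG (a : A) : G (a ⊗ₜ[ℂ] 1) = a := g.apply_tmul_one a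
  change G (a ⊗ₜ[ℂ] b) = a * G (1 ⊗ₜ[ℂ] b) ∧ G (a ⊗ₜ[ℂ] b) = G (1 ⊗ₜ[ℂ] b) * a
  have ha : a ∈ Submodule.span ℂ {p : A | star p = p ∧ p * p = p} := by
    rw [span_projections]; trivial
  have hb : b ∈ Submodule.span ℂ {b : B | IsPositiveElt b ∧ IsPositiveElt (1 - b)} := by
    rw [span_positive_contractions]; trivial
  induction ha using Submodule.span_induction with
  | zero => simp
  | add x y _ _ hx hy => simp [TensorProduct.add_tmul, hx.1, hy.1, add_mul, mul_add,
      ← hx.2, ← hy.2]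
  | smul c x _ hx =>
    rw [← TensorProduct.smul_tmul', map_smul, smul_mul_assoc, mul_smul_comm, ← hx.1, ← hx.2]
    simp
  | mem p hp =>
    induction hb using Submodule.span_induction with
    | zero => simp
    | add x y _ _ hx hy => simp [TensorProduct.tmul_add, hx.1, hy.1, add_mul, mul_add,
        ← hx.2, ← hy.2]
    | smul c x _ hx =>
      rw [TensorProduct.tmul_smul, TensorProduct.tmul_smul, map_smul, map_smul, smul_mul_assoc,
        mul_smul_comm, ← hx.1, ← hx.2]
      simp
    | mem b hb =>
      obtain ⟨⟨c, hc⟩, ⟨d, hd⟩⟩ := hb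
      -- Both q ⊗ b and q ⊗ (1 - b) are squares, so 0 ≤ G(q ⊗ b) ≤ G(q ⊗ 1) = q.
      have key (q : A) (hs : star q = q) (hm : q * q = q) :
          G (q ⊗ₜ[ℂ] b) * q = G (q ⊗ₜ[ℂ] b) ∧ q * G (q ⊗ₜ[ℂ] b) = G (q ⊗ₜ[ℂ] b) := by
        refine mul_eq_self_of_positive_le_projection hs hm (g.1.map_pos _ ⟨q ⊗ₜ c, ?_⟩) ?_
        · simp [hs, hm, hc]
        · have h := g.1.map_pos (q ⊗ₜ[ℂ] (1 - b)) ⟨q ⊗ₜ d, by simp [hs, hm, hd]⟩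
          change IsPositiveElt (G _) at h
          rwa [TensorProduct.tmul_sub, map_sub, hG] at h
      have hp1 := key p hp.1 hp.2
      have hp2 := key (1 - p) (by simp [hp.1]) (by simp [mul_sub, sub_mul, hp.2])
      rw [TensorProduct.sub_tmul, map_sub] at hp2
      set u := G (p ⊗ₜ[ℂ] b)
      set w := G (1 ⊗ₜ[ℂ] b)
      -- w - u = G((1 - p) ⊗ b) has 1 - p as a unit, so p annihilates it; then w p = u p = u, and
      -- similarly on the left.
      have h1 : (w - u) * p = 0 := by
        rw [← hp2.1, mul_assoc, sub_mul 1, one_mul, hp.2, sub_self, mul_zero]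
      have h2 : p * (w - u) = 0 := by
        rw [← hp2.2, ← mul_assoc, mul_sub p 1, mul_one, hp.2, sub_self, zero_mul]
      rw [sub_mul, hp1.1, sub_eq_zero] at h1
      rw [mul_sub, hp1.2, sub_eq_zero] at h2
      exact ⟨h2.symm, h1.symm⟩

theorem apply_one_tmul_mem_center (g : PURetraction A B) (b : B) :
    g.1 (1 ⊗ₜ[ℂ] b) ∈ cstarCenter A :=
  (mem_cstarCenter_iff A).2 fun a => (g.apply_tmul a b).2.symm.trans (g.apply_tmul a b).1

end PURetraction

/-! ### The bijections -/

section

variable {A B : Type*} [CStarAlgebra A] [CStarAlgebra B] [FiniteDimensional ℂ A]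

/-- The bijection between PU maps `B → Z(A)` and PU retractions of `κ₁ : A → A ⊗ B`. -/
noncomputable def grEquiv (A B : Type*) [CStarAlgebra A] [CStarAlgebra B]
    [FiniteDimensional ℂ A] : PUMap B (cstarCenter A) ≃ PURetraction A B where
  toFun := PUMap.gr
  invFun g := (g.1.comp (PUMap.ofStarAlgHom (kappaTwo A B))).codRestrictCenter
    g.apply_one_tmul_mem_center
  left_inv f := by
    apply PUMap.ext
    ext b
    exact one_mul (f b : A)
  right_inv g := by
    apply Subtype.ext
    apply PUMap.ext
    refine TensorProduct.ext' fun a b => ?_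
    exact (g.apply_tmul a b).1.symm

/-- For commutative `A`, PU maps into the center are the same as PU maps into `A`. -/
def centerEquivOfComm (h : ∀ x y : A, x * y = y * x) : PUMap B A ≃ PUMap B (cstarCenter A) where
  toFun f := f.codRestrictCenter fun b => (mem_cstarCenter_iff A).2 (h (f b))
  invFun f := (PUMap.ofStarAlgHom (cstarCenter A).subtype).comp f
  left_inv _ := rfl
  right_inv _ := rfl

end

theorem mainTheorem4 {A B : Type*} [CStarAlgebra A] [CStarAlgebra B]
    [FiniteDimensional ℂ A] [FiniteDimensional ℂ B] :
    (∃ gr : PUMap B (cstarCenter A) ≃ PURetraction A B,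
      (∀ f : PUMap B (cstarCenter A), (gr f).1.toLinearMap = grLinear f) ∧
      (∀ (f : PUMap B (cstarCenter A)) (a : A) (b : B),
        (gr f).1 (a ⊗ₜ[ℂ] b) = a * (f b : A) ∧ (gr f).1 (a ⊗ₜ[ℂ] b) = (f b : A) * a) ∧
      (∀ g : PURetraction A B,
        (PUMap.ofStarAlgHom (cstarCenter A).subtype).comp (gr.symm g) =
          g.1.comp (PUMap.ofStarAlgHom (kappaTwo A B)))) ∧
    ((∀ x y : A, x * y = y * x) →
      ∃ gr : PUMap B A ≃ PURetraction A B,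
        (∀ (f : PUMap B A) (a : A) (b : B),
          (gr f).1 (a ⊗ₜ[ℂ] b) = a * f b ∧ (gr f).1 (a ⊗ₜ[ℂ] b) = f b * a) ∧
        (∀ g : PURetraction A B,
          gr.symm g = g.1.comp (PUMap.ofStarAlgHom (kappaTwo A B)))) := by
  refine ⟨⟨grEquiv A B, fun _ => rfl, fun f a b => ⟨rfl, ?_⟩, fun _ => rfl⟩,
    fun h => ⟨(centerEquivOfComm h).trans (grEquiv A B), fun f a b => ⟨rfl, h _ _⟩, fun _ => rfl⟩⟩
  exact ((mem_cstarCenter_iff A).1 (f b).2 a).symm
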